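/- Let $F$ be a global field (a number field, or a finite extension of $\mathbb F_p(t)$ for some prime $p$) and let $E/F$ be a (possibly infinite) Galois extension. A place of a field is an equivalence class of nontrivial absolute values; $Y_E$ denotes the set of places of $E$. For an intermediate field $K$ of $E/F$ and a place $v$ of $K$, let $Y(E/K,v)\subseteq Y_E$ be the set of places of $E$ dividing $v$ (i.e. restricting to $v$ on $K$). Give $Y_E$ the topology generated by the sets $Y(E/M,w)$, where $M$ runs over the intermediate fields with $M/F$ finite Galois and $w$ over the places of $M$, give $Y(E/K,v)$ the subspace topology, and give $\mathrm{Gal}(E/K)$ the Krull topology. Let $E_y$ be the completion of $E$ at $y\in Y_E$. The group $\mathrm{Gal}(E/K)$ acts on $Y(E/K,v)$ in such a way that $x\mapsto|\sigma^{-1}x|$ belongs to $\sigma(y)$ whenever $|\cdot|$ belongs to $y$, and each $\sigma\in\mathrm{Gal}(E/K)$ extends by continuity to an isomorphism of topological fields $\sigma:E_y\to E_{\sigma(y)}$. A $v$-adic transition diagram on $E$ is a continuous map $\lambda:Y(E/K,v)\times Y(E/K,v)\to\mathrm{Gal}(E/K)$ such that, for all $x,y,z\in Y(E/K,v)$, $\lambda(x,x)=1$,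 $\lambda(x,y)(x)=y$ and $\lambda(y,z)\lambda(x,y)=\lambda(x,z)$. Let $K,L\subseteq E$ be finite Galois extensions of $F$. For each place $v$ of $K$ let $\lambda_v$ be a $v$-adic transition diagram on $E$ and let $r_v\in Y(E/K,v)$; for each place $w$ of $L$ let $\mu_w$ be a $w$-adic transition diagram on $E$ and let $s_w\in Y(E/L,w)$. If $(a_y)_{y\in Y_E}\in\prod_{y\in Y_E}E_y$, then the following conditions are equivalent: (i) for every place $v$ of $K$, the map $Y(E/K,v)\to E_{r_v}$, $y\mapsto\lambda_v(y,r_v)(a_y)$, is continuous; (ii) for every place $w$ of $L$, the map $Y(E/L,w)\to E_{s_w}$, $y\mapsto\mu_w(y,s_w)(a_y)$, is continuous. In other words, this continuity condition on $(a_y)_{y\in Y_E}$ is independent of the choice of the finite Galois extension $K/F$ inside $E$, of the transition diagrams, and of the base points. -/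

import Mathlib

/-- `F` is a global field: a number field, or a finite extension of the rational function field
`𝔽_p(t)` for some prime `p`. -/
def IsGlobalField (F : Type*) [Field F] : Prop :=
  NumberField F ∨
    ∃ (p : ℕ) (_ : Fact p.Prime) (_ : Algebra (RatFunc (ZMod p)) F),
      FiniteDimensional (RatFunc (ZMod p)) F

/-- The nontrivial real absolute values (Archimedean or not) on a field `E`. -/
abbrev NontrivialAbs (E : Type*) [Field E] : Type _ :=
  {a : AbsoluteValue E ℝ // a.IsNontrivial}

/-- Equivalence of nontrivial absolute values. -/
def NontrivialAbs.setoid (E : Type*) [Field E] : Setoid (NontrivialAbs E) :=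
  Setoid.comap Subtype.val (inferInstance : Setoid (AbsoluteValue E ℝ))

/-- A place of a field `E` is an equivalence class of nontrivial absolute values on `E`. -/
def Place (E : Type*) [Field E] : Type _ :=
  Quotient (NontrivialAbs.setoid E)

/-- The place of a nontrivial absolute value. -/
def NontrivialAbs.place {E : Type*} [Field E] (a : NontrivialAbs E) : Place E :=
  Quotient.mk (NontrivialAbs.setoid E) a

theorem NontrivialAbs.place_eq_iff {E : Type*} [Field E] (a b : NontrivialAbs E) :
    a.place = b.place ↔ a.1.IsEquiv b.1 :=
  Quotient.eq (r := NontrivialAbs.setoid E)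

/-- The place `y` of `E` divides the place `v` of the subfield `K`: an absolute value in the
class `y` restricts to an absolute value on `K` in the class `v`. -/
def Place.Divides {K E : Type*} [Field K] [Field E] [Algebra K E]
    (y : Place E) (v : Place K) : Prop :=
  ∃ (a : NontrivialAbs E) (b : NontrivialAbs K),
    a.place = y ∧ b.place = v ∧ a.1.comp (algebraMap K E).injective = b.1

/-- The absolute value `x ↦ |σ⁻¹ x|`. -/
def NontrivialAbs.transport {K E : Type*} [Field K] [Field E] [Algebra K E]
    (σ : E ≃ₐ[K] E) (a : NontrivialAbs E) : NontrivialAbs E :=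
  ⟨a.1.comp (f := (σ.symm : E →+* E)) σ.symm.injective, by
    obtain ⟨x, hx, hx1⟩ := a.2
    refine ⟨σ x, by simpa using hx, ?_⟩
    change a.1 (σ.symm (σ x)) ≠ 1
    rwa [σ.symm_apply_apply]⟩

theorem NontrivialAbs.transport_apply {K E : Type*} [Field K] [Field E] [Algebra K E]
    (σ : E ≃ₐ[K] E) (a : NontrivialAbs E) (x : E) : (a.transport σ).1 x = a.1 (σ.symm x) :=
  rfl

/-- The action of `Gal(E/K)` on the places of `E`; it satisfies `|σ x|_{σ y} = |x|_y`. -/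
instance Place.instMulAction {K E : Type*} [Field K] [Field E] [Algebra K E] :
    MulAction (E ≃ₐ[K] E) (Place E) where
  smul σ := Quotient.map (NontrivialAbs.transport σ)
    (fun _ _ h x y => h (σ.symm x) (σ.symm y))
  one_smul y := Quotient.inductionOn y fun _ => rfl
  mul_smul _ _ y := Quotient.inductionOn y fun _ => rfl

theorem Place.smul_place {K E : Type*} [Field K] [Field E] [Algebra K E]
    (σ : E ≃ₐ[K] E) (a : NontrivialAbs E) : σ • a.place = (a.transport σ).place :=
  rfl

/-- A choice of one absolute value `|·|_y` in every place `y` of `E`. -/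
structure AbsChoice (E : Type*) [Field E] where
  /-- the chosen absolute value -/
  abv : Place E → NontrivialAbs E
  abv_place : ∀ y, (abv y).place = y

/-- The completion `E_y` of `E` at the place `y`. As a topological field it does not depend on
the absolute value chosen in `y`. -/
abbrev AbsChoice.Completion {E : Type*} [Field E] (ρ : AbsChoice E) (y : Place E) : Type _ :=
  (ρ.abv y).1.Completion

theorem AbsChoice.continuous_map {K E : Type*} [Field K] [Field E] [Algebra K E]
    (ρ : AbsChoice E) (σ : E ≃ₐ[K] E) {y z : Place E} (h : σ • y = z) :
    Continuous (WithAbs.map (ρ.abv y).1 (ρ.abv z).1 (σ : E →+* E)) := by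
  have he : ((ρ.abv y).transport σ).1.IsEquiv (ρ.abv z).1 := by
    rw [← NontrivialAbs.place_eq_iff, ← Place.smul_place, ρ.abv_place, ρ.abv_place, h]
  have h1 : Continuous
      (WithAbs.map (ρ.abv y).1 ((ρ.abv y).transport σ).1 (σ : E →+* E)) := by
    refine AddMonoidHomClass.continuous_of_bound _ 1 fun x => ?_
    rw [WithAbs.norm_eq_apply_ofAbs, WithAbs.norm_eq_apply_ofAbs,
      NontrivialAbs.transport_apply]
    simp
  exact he.isEmbedding_equivWithAbs.continuous.comp h1

/-- The extension by continuity `E_y → E_z` of `σ ∈ Gal(E/K)`, where `z = σ(y)`. -/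
noncomputable def AbsChoice.galMap {K E : Type*} [Field K] [Field E] [Algebra K E]
    (ρ : AbsChoice E) (σ : E ≃ₐ[K] E) {y z : Place E} (h : σ • y = z) :
    ρ.Completion y →+* ρ.Completion z :=
  UniformSpace.Completion.mapRingHom _ (ρ.continuous_map σ h)

theorem AbsChoice.galMap_coe {K E : Type*} [Field K] [Field E] [Algebra K E]
    (ρ : AbsChoice E) (σ : E ≃ₐ[K] E) {y z : Place E} (h : σ • y = z) (x : E) :
    ρ.galMap σ h (x : (ρ.abv y).1.Completion) = ((σ x : E) : (ρ.abv z).1.Completion) :=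
  UniformSpace.Completion.mapRingHom_coe (ρ.continuous_map σ h) _

theorem AbsChoice.continuous_galMap {K E : Type*} [Field K] [Field E] [Algebra K E]
    (ρ : AbsChoice E) (σ : E ≃ₐ[K] E) {y z : Place E} (h : σ • y = z) :
    Continuous (ρ.galMap σ h) :=
  UniformSpace.Completion.continuous_map

/-- The set `Y(E/K,v)` of the places of `E` that divide the place `v` of `K`. -/
def PlacesOver {F E : Type*} [Field F] [Field E] [Algebra F E]
    (K : IntermediateField F E) (v : Place K) : Type _ :=
  {y : Place E // y.Divides v}

/-- The topology on the set of places of `E` that is generated by the sets `Y(E/M,w)`, where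
`M/F` is finite Galois, `M ⊆ E`, and `w` is a place of `M`. -/
abbrev placeTopology (F E : Type*) [Field F] [Field E] [Algebra F E] :
    TopologicalSpace (Place E) :=
  TopologicalSpace.generateFrom
    {S | ∃ (M : IntermediateField F E) (w : Place M),
      FiniteDimensional F M ∧ IsGalois F M ∧ S = {y | y.Divides w}}

/-- `Y(E/K,v)` carries the subspace topology. -/
instance PlacesOver.instTopologicalSpace {F E : Type*} [Field F] [Field E] [Algebra F E]
    (K : IntermediateField F E) (v : Place K) : TopologicalSpace (PlacesOver K v) :=
  (placeTopology F E).induced Subtype.val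

/-- A `v`-adic transition diagram on `E`: an element of `T(E/K,v)`. The Galois group carries the
Krull topology. -/
structure TransitionDiagram {F E : Type*} [Field F] [Field E] [Algebra F E]
    (K : IntermediateField F E) (v : Place K) where
  /-- the underlying map `Y(E/K,v) × Y(E/K,v) → Gal(E/K)` -/
  toFun : PlacesOver K v × PlacesOver K v → (E ≃ₐ[K] E)
  map_self : ∀ x, toFun (x, x) = 1
  map_smul : ∀ x y, toFun (x, y) • x.1 = y.1
  map_mul : ∀ x y z, toFun (y, z) * toFun (x, y) = toFun (x, z)
  continuous_toFun : Continuous toFun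

/-!
The condition in the theorem is shown to be equivalent to one in which neither the intermediate
field, nor the transition diagrams, nor the base points occur (`IsContinuousFamily`): whenever
`e ∈ E` approximates `a y₀` in `E_{y₀}` up to `ε`, every `y` near `y₀` is carried to `y₀` by some
`σ ∈ Gal(E/F)` such that `σ (a y - e)` has norm less than `ε` in `E_{y₀}`.

The equivalence (`forall_continuous_iff_isContinuousFamily`) rests on three facts.

* The norm of `σ (a y - e)` in `E_{y₀}` does not depend on the choice of `σ` with `σ y = y₀`
  (`AbsChoice.norm_galMap_eq`). Indeed an element `τ` of the decomposition group of `y₀` preserves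
  the absolute value `|·|` and not only its class: if `|x| < |τ x|`, then `|τⁿ x|` is strictly
  increasing in `n`, whereas the orbit of `x` is finite because `x` is algebraic over `F`.
* Every place of `E` lies over a place of `K` (`Place.exists_divides`), since an absolute value that
  is trivial on `K` is trivial on the algebraic extension `E`; and `Y(E/K,v)` is open in `Y_E`.
* The stabilizer of `e` in `Gal(E/K)` is open in the Krull topology, so `λ(y,y₀)` fixes `e` for `y`
  near `y₀`, and `λ(y,y₀)(a y - e) = λ(y,y₀)(a y) - e`. Changing the base point from `r` to `y₀`
  only composes the map `y ↦ λ(y,r)(a y)` with the homeomorphism `λ(r,y₀)`.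
-/

open Topology Filter Polynomial

/-! ### Absolute values on algebraic extensions -/

/-- An absolute value that is trivial on `K` is bounded on `K[x]` for `x` algebraic over `K`, in
particular on the powers of `x`, which is impossible if `|x| > 1`. -/
theorem AbsoluteValue.IsNontrivial.comp_algebraMap {K E : Type*} [Field K] [Field E] [Algebra K E]
    [Algebra.IsAlgebraic K E] {a : AbsoluteValue E ℝ} (ha : a.IsNontrivial) :
    (a.comp (algebraMap K E).injective).IsNontrivial := by
  by_contra hK
  obtain ⟨x, hx⟩ := ha.exists_abv_gt_one
  have hle (c : K) : a (algebraMap K E c) ≤ 1 := by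
    rcases eq_or_ne c 0 with rfl | hc
    · simp
    · exact (AbsoluteValue.not_isNontrivial_apply hK hc).le
  have hint : IsIntegral K x := Algebra.IsIntegral.isIntegral x
  have hmonic := minpoly.monic hint
  have hbound (k : ℕ) :
      a x ^ k ≤ ∑ i ∈ Finset.range (minpoly K x).natDegree, a x ^ i := by
    have hdeg : ((X ^ k : K[X]) %ₘ minpoly K x).natDegree < (minpoly K x).natDegree :=
      natDegree_modByMonic_lt _ hmonic (minpoly.ne_one K x)
    have hpow : x ^ k = aeval x ((X ^ k : K[X]) %ₘ minpoly K x) := by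
      rw [aeval_modByMonic_eq_self_of_root (minpoly.aeval K x)]
      simp
    rw [← map_pow, hpow, aeval_eq_sum_range' hdeg]
    refine (a.sum_le _ _).trans (Finset.sum_le_sum fun i _ => ?_)
    rw [Algebra.smul_def, map_mul, map_pow]
    exact mul_le_of_le_one_left (by positivity) (hle _)
  obtain ⟨k, hk⟩ := pow_unbounded_of_one_lt _ hx
  exact (hbound k).not_gt hk

/-- An automorphism of an algebraic extension that preserves the equivalence class of an absolute
value preserves the absolute value. -/
theorem AbsoluteValue.apply_algEquiv_eq_of_isEquiv {F E : Type*} [Field F] [Field E] [Algebra F E]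
    [Algebra.IsAlgebraic F E] {a : AbsoluteValue E ℝ} (τ : E ≃ₐ[F] E)
    (h : ∀ x y, a (τ x) ≤ a (τ y) ↔ a x ≤ a y) (x : E) : a (τ x) = a x := by
  have hlt (x y : E) : a (τ x) < a (τ y) ↔ a x < a y := by
    rw [← not_le, ← not_le, h]
  let orb : ℕ → E := fun n => τ^[n] x
  have hsucc (n : ℕ) : orb (n + 1) = τ (orb n) := Function.iterate_succ_apply' _ _ _
  -- The orbit consists of roots of the minimal polynomial, hence is not injective.
  have hninj : ¬ Function.Injective orb := by
    intro hinj
    refine Set.infinite_range_of_injective hinj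
      (((minpoly F x).rootSet_finite E).subset ?_)
    rintro _ ⟨n, rfl⟩
    rw [mem_rootSet]
    refine ⟨minpoly.ne_zero (Algebra.IsIntegral.isIntegral x), ?_⟩
    induction n with
    | zero => exact minpoly.aeval F x
    | succ n ih => rw [hsucc, aeval_algEquiv, AlgHom.comp_apply, ih]; exact map_zero _
  rcases lt_trichotomy (a (τ x)) (a x) with hx | hx | hx
  · have hanti : StrictAnti fun n => a (orb n) := strictAnti_nat_of_succ_lt fun n => by
      induction n with
      | zero => exact hx
      | succ n ih => rw [hsucc (n + 1), hsucc n, hlt, ← hsucc]; exact ih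
    exact (hninj hanti.injective.of_comp).elim
  · exact hx
  · have hmono : StrictMono fun n => a (orb n) := strictMono_nat_of_lt_succ fun n => by
      induction n with
      | zero => exact hx
      | succ n ih => rw [hsucc (n + 1), hsucc n, hlt, ← hsucc]; exact ih
    exact (hninj hmono.injective.of_comp).elim

/-! ### Places below a given place -/

theorem Place.exists_divides {K E : Type*} [Field K] [Field E] [Algebra K E]
    [Algebra.IsAlgebraic K E] (y : Place E) : ∃ v : Place K, y.Divides v := by
  induction y using Quotient.inductionOn with
  | _ a => exact ⟨_, a, ⟨_, a.2.comp_algebraMap⟩, rfl, rfl, rfl⟩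

theorem isOpen_divides {F E : Type*} [Field F] [Field E] [Algebra F E]
    (K : IntermediateField F E) [FiniteDimensional F K] [IsGalois F K] (v : Place K) :
    IsOpen[placeTopology F E] {y | y.Divides v} :=
  TopologicalSpace.isOpen_generateFrom_of_mem ⟨K, v, inferInstance, inferInstance, rfl⟩

/-! ### Galois maps between completions -/

namespace AbsChoice

variable {F E : Type*} [Field F] [Field E] [Algebra F E] (ρ : AbsChoice E)

theorem galMap_galMap {σ τ υ : E ≃ₐ[F] E} {x y z : Place E} (hσ : σ • x = y) (hτ : τ • y = z)
    (hυ : υ • x = z) (h : τ * σ = υ) (t : ρ.Completion x) :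
    ρ.galMap τ hτ (ρ.galMap σ hσ t) = ρ.galMap υ hυ t := by
  subst h
  induction t using UniformSpace.Completion.induction_on with
  | hp =>
    exact isClosed_eq ((ρ.continuous_galMap τ hτ).comp (ρ.continuous_galMap σ hσ))
      (ρ.continuous_galMap _ hυ)
  | ih t =>
    have h1 := ρ.galMap_coe σ hσ t.ofAbs
    have h2 := ρ.galMap_coe τ hτ (σ t.ofAbs)
    have h3 := ρ.galMap_coe (τ * σ) hυ t.ofAbs
    rw [WithAbs.toAbs_ofAbs] at h1 h3
    rw [h1, h2, h3, AlgEquiv.mul_apply]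

theorem galMap_eq_self {σ : E ≃ₐ[F] E} {y : Place E} (hσ : σ • y = y) (h : σ = 1)
    (t : ρ.Completion y) : ρ.galMap σ hσ t = t := by
  subst h
  induction t using UniformSpace.Completion.induction_on with
  | hp => exact isClosed_eq (ρ.continuous_galMap _ hσ) continuous_id
  | ih t => exact ρ.galMap_coe 1 hσ t.ofAbs

theorem abv_apply_eq_of_smul_eq [Algebra.IsAlgebraic F E] {τ : E ≃ₐ[F] E} {z : Place E}
    (hτ : τ • z = z) (x : E) : (ρ.abv z).1 (τ x) = (ρ.abv z).1 x := by
  have he : ((ρ.abv z).transport τ).1.IsEquiv (ρ.abv z).1 := by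
    rw [← NontrivialAbs.place_eq_iff, ← Place.smul_place, ρ.abv_place, hτ]
  refine AbsoluteValue.apply_algEquiv_eq_of_isEquiv τ (fun x y => ?_) x
  rw [← he.le_iff_le, NontrivialAbs.transport_apply, NontrivialAbs.transport_apply]
  simp

/-- The norm that `E_y` acquires from `E_z` through `σ` with `σ y = z` does not depend on `σ`. -/
theorem norm_galMap_eq [Algebra.IsAlgebraic F E] {σ τ : E ≃ₐ[F] E} {y z : Place E}
    (hσ : σ • y = z) (hτ : τ • y = z) (t : ρ.Completion y) :
    ‖ρ.galMap σ hσ t‖ = ‖ρ.galMap τ hτ t‖ := by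
  induction t using UniformSpace.Completion.induction_on with
  | hp =>
    exact isClosed_eq (ρ.continuous_galMap σ hσ).norm (ρ.continuous_galMap τ hτ).norm
  | ih t =>
    have h1 := ρ.galMap_coe σ hσ t.ofAbs
    have h2 := ρ.galMap_coe τ hτ t.ofAbs
    rw [WithAbs.toAbs_ofAbs] at h1 h2
    have hfix : (σ * τ⁻¹) • z = z := by rw [mul_smul, ← hτ, inv_smul_smul, hσ, hτ]
    have h3 := ρ.abv_apply_eq_of_smul_eq hfix (τ t.ofAbs)
    rw [AlgEquiv.mul_apply, ← AlgEquiv.mul_apply τ⁻¹ τ, inv_mul_cancel, AlgEquiv.one_apply] at h3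
    rw [h1, h2, UniformSpace.Completion.norm_coe, UniformSpace.Completion.norm_coe]
    exact h3

theorem exists_norm_sub_coe_lt {y : Place E} (t : ρ.Completion y) {ε : ℝ} (hε : 0 < ε) :
    ∃ e : E, ‖t - (e : (ρ.abv y).1.Completion)‖ < ε := by
  obtain ⟨e, he⟩ :=
    (UniformSpace.Completion.denseRange_coe (α := WithAbs (ρ.abv y).1)).exists_dist_lt t hε
  exact ⟨e.ofAbs, by rwa [WithAbs.toAbs_ofAbs, ← dist_eq_norm]⟩

end AbsChoice

/-! ### A criterion without transition diagrams -/

/-- Continuity of a family `a y ∈ E_y`, expressed without transition diagrams: if `e ∈ E`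
approximates `a y₀` up to `ε`, then it approximates `a y` up to `ε` for all `y` near `y₀`, where
the norm on `E_y` is the one transported from `E_{y₀}` by an element of `Gal(E/F)`. -/
def IsContinuousFamily (F : Type*) {E : Type*} [Field F] [Field E] [Algebra F E]
    (ρ : AbsChoice E) (a : ∀ y : Place E, ρ.Completion y) : Prop :=
  ∀ (y₀ : Place E) (e : E) (ε : ℝ), ‖a y₀ - (e : (ρ.abv y₀).1.Completion)‖ < ε →
    ∀ᶠ y in @nhds _ (placeTopology F E) y₀, ∃ (σ : E ≃ₐ[F] E) (h : σ • y = y₀),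
      ‖ρ.galMap σ h (a y - (e : (ρ.abv y).1.Completion))‖ < ε

namespace TransitionDiagram

variable {F E : Type*} [Field F] [Field E] [Algebra F E] {K : IntermediateField F E} {v : Place K}
  (lam : TransitionDiagram K v)

theorem continuous_galMap_iff (ρ : AbsChoice E) (a : ∀ y : Place E, ρ.Completion y)
    (r s : PlacesOver K v) :
    (Continuous fun y : PlacesOver K v => ρ.galMap (lam.toFun (y, r)) (lam.map_smul y r) (a y.1)) ↔
      Continuous fun y : PlacesOver K v =>
        ρ.galMap (lam.toFun (y, s)) (lam.map_smul y s) (a y.1) := by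
  have key (r s : PlacesOver K v) (h : Continuous fun y : PlacesOver K v =>
      ρ.galMap (lam.toFun (y, r)) (lam.map_smul y r) (a y.1)) : Continuous fun y : PlacesOver K v =>
        ρ.galMap (lam.toFun (y, s)) (lam.map_smul y s) (a y.1) := by
    refine ((ρ.continuous_galMap (lam.toFun (r, s)) (lam.map_smul r s)).comp h).congr fun y => ?_
    exact ρ.galMap_galMap _ _ _ (lam.map_mul y r s) _
  exact ⟨key r s, key s r⟩

/-- Near `y₀` the automorphism `λ(y,y₀)` fixes a given element of `E`. -/
theorem eventually_apply_eq [Algebra.IsAlgebraic F E] (y₀ : PlacesOver K v) (e : E) :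
    ∀ᶠ y in 𝓝 y₀, lam.toFun (y, y₀) e = e := by
  have hK : Algebra.IsAlgebraic K E := Algebra.IsAlgebraic.tower_top (K := F) K
  have hcont : Continuous fun y => lam.toFun (y, y₀) :=
    lam.continuous_toFun.comp (by fun_prop)
  have hopen : IsOpen (MulAction.stabilizer (E ≃ₐ[K] E) e : Set (E ≃ₐ[K] E)) :=
    stabilizer_isOpen_of_isIntegral e
  exact (hopen.preimage hcont).mem_nhds (by simp [lam.map_self])

end TransitionDiagram

theorem forall_continuous_iff_isContinuousFamily {F E : Type*} [Field F] [Field E] [Algebra F E]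
    [Algebra.IsAlgebraic F E] (ρ : AbsChoice E) (K : IntermediateField F E)
    [FiniteDimensional F K] [IsGalois F K]
    (lam : ∀ v : Place K, TransitionDiagram K v) (r : ∀ v : Place K, PlacesOver K v)
    (a : ∀ y : Place E, ρ.Completion y) :
    (∀ v : Place K, Continuous fun y : PlacesOver K v =>
        ρ.galMap ((lam v).toFun (y, r v)) ((lam v).map_smul y (r v)) (a y.1)) ↔
      IsContinuousFamily F ρ a := by
  let : TopologicalSpace (Place E) := placeTopology F E
  have hval (v : Place K) : IsInducing (fun y : PlacesOver K v => y.1) := ⟨rfl⟩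
  have hself {v : Place K} (y : PlacesOver K v) :
      ρ.galMap ((lam v).toFun (y, y)) ((lam v).map_smul y y) (a y.1) = a y.1 :=
    ρ.galMap_eq_self _ ((lam v).map_self y) _
  have hsub {v : Place K} {y y₀ : PlacesOver K v} {e : E} (he : (lam v).toFun (y, y₀) e = e) :
      ρ.galMap ((lam v).toFun (y, y₀)) ((lam v).map_smul y y₀)
          (a y.1 - (e : (ρ.abv y.1).1.Completion)) =
        ρ.galMap ((lam v).toFun (y, y₀)) ((lam v).map_smul y y₀) (a y.1) -
          (e : (ρ.abv y₀.1).1.Completion) := by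
    rw [map_sub, ρ.galMap_coe, he]
  constructor
  · intro h y₀ e ε he
    have : Algebra.IsAlgebraic K E := Algebra.IsAlgebraic.tower_top (K := F) K
    obtain ⟨v, hv⟩ := y₀.exists_divides (K := K)
    let z₀ : PlacesOver K v := ⟨y₀, hv⟩
    have hcont := ((lam v).continuous_galMap_iff ρ a (r v) z₀).1 (h v)
    have hnear : ∀ᶠ y : PlacesOver K v in 𝓝 z₀,
        ‖ρ.galMap ((lam v).toFun (y, z₀)) ((lam v).map_smul y z₀) (a y.1) -
          (e : (ρ.abv z₀.1).1.Completion)‖ < ε := by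
      refine (hcont.sub continuous_const).norm.continuousAt.eventually_lt_const ?_
      change ‖ρ.galMap ((lam v).toFun (z₀, z₀)) ((lam v).map_smul z₀ z₀) (a z₀.1) -
        (e : (ρ.abv z₀.1).1.Completion)‖ < ε
      rw [hself]
      exact he
    have hall := hnear.and ((lam v).eventually_apply_eq z₀ e)
    rw [(hval v).nhds_eq_comap, eventually_comap] at hall
    filter_upwards [hall, (isOpen_divides K v).mem_nhds hv] with y hy hyv
    obtain ⟨hlt, hfix⟩ := hy ⟨y, hyv⟩ rfl
    refine ⟨((lam v).toFun (⟨y, hyv⟩, z₀)).restrictScalars F, (lam v).map_smul ⟨y, hyv⟩ z₀, ?_⟩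
    rw [← hsub hfix] at hlt
    exact hlt
  · intro h v
    rw [continuous_iff_continuousAt]
    intro y₀
    suffices hy : ContinuousAt (fun y : PlacesOver K v =>
        ρ.galMap ((lam v).toFun (y, y₀)) ((lam v).map_smul y y₀) (a y.1)) y₀ by
      refine ((ρ.continuous_galMap ((lam v).toFun (y₀, r v))
        ((lam v).map_smul y₀ (r v))).continuousAt.comp hy).congr (.of_forall fun y => ?_)
      exact ρ.galMap_galMap _ _ _ ((lam v).map_mul y y₀ (r v)) _
    rw [ContinuousAt, hself, Metric.tendsto_nhds]
    intro ε hε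
    obtain ⟨e, he⟩ := ρ.exists_norm_sub_coe_lt (a y₀.1) (half_pos hε)
    filter_upwards [(hval v).continuous.continuousAt.eventually (h y₀.1 e _ he),
      (lam v).eventually_apply_eq y₀ e] with y hy hfix
    obtain ⟨σ, hσ, hlt⟩ := hy
    have hlt' : ‖ρ.galMap ((lam v).toFun (y, y₀)) ((lam v).map_smul y y₀)
        (a y.1 - (e : (ρ.abv y.1).1.Completion))‖ < ε / 2 := by
      refine lt_of_eq_of_lt (ρ.norm_galMap_eq (F := F)
        (σ := ((lam v).toFun (y, y₀)).restrictScalars F) ((lam v).map_smul y y₀) hσ _) hlt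
    rw [hsub hfix] at hlt'
    rw [dist_eq_norm, ← sub_sub_sub_cancel_right _ _ (e : (ρ.abv y₀.1).1.Completion)]
    exact (norm_sub_le _ _).trans_lt (by linarith)

theorem theorem5 {F E : Type*} [Field F] [Field E] [Algebra F E] (hF : IsGlobalField F)
    [IsGalois F E] (ρ : AbsChoice E)
    (K L : IntermediateField F E)
    [FiniteDimensional F K] [IsGalois F K] [FiniteDimensional F L] [IsGalois F L]
    (lam : ∀ v : Place K, TransitionDiagram K v) (r : ∀ v : Place K, PlacesOver K v)
    (mu : ∀ w : Place L, TransitionDiagram L w) (s : ∀ w : Place L, PlacesOver L w)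
    (a : ∀ y : Place E, ρ.Completion y) :
    (∀ v : Place K, Continuous fun y : PlacesOver K v =>
        ρ.galMap ((lam v).toFun (y, r v)) ((lam v).map_smul y (r v)) (a y.1)) ↔
      (∀ w : Place L, Continuous fun y : PlacesOver L w =>
        ρ.galMap ((mu w).toFun (y, s w)) ((mu w).map_smul y (s w)) (a y.1)) :=
  (forall_continuous_iff_isContinuousFamily ρ K lam r a).trans
    (forall_continuous_iff_isContinuousFamily ρ L mu s a).symm
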